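/- Let $L^2=L^2(\mathbb T)$ (normalized arc length) and let $H^2\subset L^2$ be the closed subspace of functions whose Fourier coefficients of negative index vanish. Let $P_+$ and $P_-=1-P_+$ be the orthogonal projections of $L^2$ onto $H^2$ and $H^2_-:=(H^2)^\perp$. Let $\pi$ be the quotient map of $\mathcal B(L^2)$ onto the Calkin algebra (bounded operators modulo compact operators). For $k\in\mathbb Z$ let $Gr_{res}^k$ be the set of orthogonal projections $P_W$ onto closed subspaces $W\subset L^2$ such that $P_+|_W:W\to H^2$ is a Fredholm operator of index $k$ (index $=\dim\ker-\dim\operatorname{coker}$) and $P_-|_W:W\to H^2_-$ is compact. Let $\mathbb E_1$ be the set of orthogonal projections $P\in\mathcal B(L^2)$ such that $PP_+-P_+P$ is compact and, with respect to the decomposition $1=\pi(P_+)+\pi(P_-)$, $$\pi(P)=\begin{pmatrix} p&0\\0&0\end{pmatrix},$$ where $p$ is a projection in $\pi(P_+)\,\pi(\mathcal B(L^2))\,\pi(P_+)$ with $p\neq 0$ and $p\neq \pi(P_+)$ (the unit of this corner algebra). Let $\varphi$ be an inner function, that is, $\varphi\in H^2$ and $|\varphi|=1$ a.e. on $\mathbb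 T$, and let $P_\varphi$ be the orthogonal projection of $L^2$ onto $\varphi H^2$. Call $\varphi$ a finite Blaschke product if its holomorphic extension to the unit disk $\mathbb D$ has the form $\lambda\prod_{j=1}^n b_{a_j}$ with $|\lambda|=1$, $0\le n<\infty$ and $a_j\in\mathbb D$ (for $n=0$ this is the constant $\lambda$), where $b_a(z)=\frac{\overline a}{|a|}\frac{a-z}{1-\overline a z}$ for $a\ne0$ and $b_0(z)=z$. Then: (i) $\varphi$ is a finite Blaschke product if and only if the number $k$ of zeros in $\mathbb D$, counted with multiplicity, of the holomorphic extension of $\varphi$ is finite and $P_\varphi\in Gr_{res}^{-k}$. (ii) $\varphi$ is not a finite Blaschke product if and only if $P_\varphi\in\mathbb E_1$. -/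

import Mathlib

open MeasureTheory Filter Topology
open scoped ENNReal ComplexConjugate

noncomputable section

namespace HardySpace

instance factTwoPiPos : Fact ((0 : ℝ) < 2 * Real.pi) := ⟨Real.two_pi_pos⟩

/-- The unit circle, parametrized by the angle `t ∈ ℝ / 2πℤ`. The character
`χ_k (e^{it}) = e^{ikt}` is `fourier k`. -/
abbrev Circ : Type := AddCircle (2 * Real.pi)

/-- Normalized arc length measure `dt / 2π`. -/
abbrev arc : Measure Circ := AddCircle.haarAddCircle

/-- The Hilbert space `L²` of the unit circle. -/
abbrev L2 : Type := Lp ℂ 2 arc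

/-- The Hardy space `H²`, as the space of all `f ∈ L²` whose Fourier coefficients of negative
index vanish. -/
def H2 : Submodule ℂ L2 where
  carrier := {f | ∀ n : ℤ, n < 0 → fourierCoeff (f : Circ → ℂ) n = 0}
  zero_mem' := fun n _ => by
    rw [← fourierBasis_repr]; simp
  add_mem' := fun {f g} hf hg n hn => by
    have h1 := hf n hn
    have h2 := hg n hn
    rw [← fourierBasis_repr] at h1 h2 ⊢
    rw [map_add]
    simp [h1, h2]
  smul_mem' := fun c f hf n hn => by
    have h1 := hf n hn
    rw [← fourierBasis_repr] at h1 ⊢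
    rw [map_smul]
    simp [h1]

theorem mem_H2 {f : L2} :
    f ∈ H2 ↔ ∀ n : ℤ, n < 0 → fourierCoeff (f : Circ → ℂ) n = 0 := Iff.rfl

theorem isClosed_H2 : IsClosed (H2 : Set L2) := by
  have h : (H2 : Set L2) = ⋂ n : ℤ, ⋂ _ : n < 0,
      {f : L2 | inner ℂ (fourierBasis (T := 2 * Real.pi) n) f = 0} := by
    ext f
    simp only [SetLike.mem_coe, mem_H2, Set.mem_iInter, Set.mem_ofPred_eq]
    refine forall₂_congr fun n _ => ?_
    rw [← fourierBasis_repr, HilbertBasis.repr_apply_apply]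
  rw [h]
  refine isClosed_iInter fun n => isClosed_iInter fun _ => ?_
  exact isClosed_eq (continuous_const.inner continuous_id) continuous_const

instance completeSpace_H2 : CompleteSpace H2 := isClosed_H2.completeSpace_coe

/-- The orthogonal projection `P_+` of `L²` onto `H²`. -/
def Pplus : L2 →L[ℂ] L2 := H2.starProjection

/-- The orthogonal projection `P_-` of `L²` onto `H²_-`, the orthogonal complement of `H²`. -/
def Pminus : L2 →L[ℂ] L2 := H2ᗮ.starProjection

/-- An inner function: a function `φ ∈ H²` that is unimodular almost everywhere on the circle. -/
structure IsInner (φ : L2) : Prop where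
  mem_H2 : φ ∈ H2
  norm_eq_one : ∀ᵐ t ∂arc, ‖φ t‖ = 1

theorem IsInner.memLp_mul {φ : L2} (hφ : IsInner φ) (f : L2) :
    MemLp (fun t => φ t * f t) 2 arc := by
  refine (Lp.memLp f).of_le ((Lp.aestronglyMeasurable φ).mul (Lp.aestronglyMeasurable f)) ?_
  filter_upwards [hφ.norm_eq_one] with t ht
  simp [ht]

/-- The multiplication operator `M_φ f = φ f` on `L²`, which is isometric for inner `φ`. -/
def mulOp (φ : L2) (hφ : IsInner φ) : L2 →ₗᵢ[ℂ] L2 where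
  toFun f := (hφ.memLp_mul f).toLp _
  map_add' f g := by
    rw [← MemLp.toLp_add]
    apply MemLp.toLp_congr
    filter_upwards [Lp.coeFn_add f g] with t ht
    rw [ht, Pi.add_apply, Pi.add_apply, mul_add]
  map_smul' c f := by
    rw [RingHom.id_apply, ← MemLp.toLp_const_smul]
    apply MemLp.toLp_congr
    filter_upwards [Lp.coeFn_smul c f] with t ht
    rw [ht, Pi.smul_apply, Pi.smul_apply, smul_eq_mul, smul_eq_mul, mul_left_comm]
  norm_map' f := by
    change ‖(hφ.memLp_mul f).toLp _‖ = ‖f‖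
    rw [Lp.norm_toLp, Lp.norm_def]
    congr 1
    apply eLpNorm_congr_norm_ae
    filter_upwards [hφ.norm_eq_one] with t ht
    simp [ht]

theorem mulOp_coeFn (φ : L2) (hφ : IsInner φ) (f : L2) :
    (mulOp φ hφ f : Circ → ℂ) =ᵐ[arc] fun t => φ t * f t :=
  (hφ.memLp_mul f).coeFn_toLp

/-- The subspace `φ H² = {φ f : f ∈ H²}`. -/
def mulH2 (φ : L2) (hφ : IsInner φ) : Submodule ℂ L2 := H2.map (mulOp φ hφ).toLinearMap

instance completeSpace_mulH2 (φ : L2) (hφ : IsInner φ) : CompleteSpace (mulH2 φ hφ) :=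
  ((mulOp φ hφ).isometry.isClosedEmbedding.isClosedMap _ isClosed_H2).completeSpace_coe

/-- The orthogonal projection `P_φ` of `L²` onto `φ H²`. -/
def innerProj (φ : L2) (hφ : IsInner φ) : L2 →L[ℂ] L2 := (mulH2 φ hφ).starProjection

/-- The holomorphic extension to the unit disk of a function in `H²`,
`z ↦ ∑_{n ≥ 0} φ_n zⁿ`, where `φ_n` are the Fourier coefficients. -/
def diskExt (φ : L2) (z : ℂ) : ℂ := ∑' n : ℕ, fourierCoeff (φ : Circ → ℂ) (n : ℤ) * z ^ n

/-- The number of zeros in the open unit disk, counted with multiplicity. -/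
def numZeros (φ : L2) : ℕ∞ :=
  ⨆ s : Finset (Metric.ball (0 : ℂ) 1), ∑ z ∈ s, analyticOrderAt (diskExt φ) (z : ℂ)

/-- The Blaschke factor `b_a`, with `b_0 (z) = z`. -/
def blaschkeFactor (a z : ℂ) : ℂ :=
  if a = 0 then z else (conj a / (‖a‖ : ℂ)) * ((a - z) / (1 - conj a * z))

/-- `φ` is (up to a unimodular constant) a finite product of Blaschke factors; the empty product
is included. -/
def IsFiniteBlaschke (φ : L2) : Prop :=
  ∃ (c : ℂ) (n : ℕ) (a : Fin n → ℂ), ‖c‖ = 1 ∧ (∀ j, ‖a j‖ < 1) ∧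
    ∀ z : ℂ, ‖z‖ < 1 → diskExt φ z = c * ∏ j, blaschkeFactor (a j) z

/-- Membership of a closed subspace `W` of `L²` in the compact restricted Grassmannian:
`P_+|_W : W → H²` is Fredholm and `P_-|_W : W → H²_-` is compact. -/
def IsInGrRes (W : Submodule ℂ L2) : Prop :=
  IsClosed (W : Set L2) ∧
    (H2.orthogonalProjectionOnto ∘L W.subtypeL).IsFredholm ∧
    IsCompactOperator (H2ᗮ.orthogonalProjectionOnto ∘L W.subtypeL)

/-- The component `Gr_res^k` of the compact restricted Grassmannian, as a set of orthogonal
projections (a closed subspace is identified with the orthogonal projection onto it). The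
Fredholm index is `dim ker - dim coker`. -/
def GrRes (k : ℤ) : Set (L2 →L[ℂ] L2) :=
  {P | IsStarProjection P ∧ IsInGrRes P.range ∧
    (H2.orthogonalProjectionOnto ∘L P.range.subtypeL).toLinearMap.index = k}

section Calkin

variable (H : Type*) [NormedAddCommGroup H] [InnerProductSpace ℂ H]

/-- The two-sided ideal of compact operators in `B(H)`. -/
def compactIdeal : TwoSidedIdeal (H →L[ℂ] H) :=
  TwoSidedIdeal.mk' {T | IsCompactOperator T} isCompactOperator_zero
    (fun {_ _} hS hT => hS.add hT) (fun {_} hT => hT.neg)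
    (fun {S _} hT => hT.clm_comp S) (fun {_ T} hS => hS.comp_clm T)

theorem mem_compactIdeal {T : H →L[ℂ] H} : T ∈ compactIdeal H ↔ IsCompactOperator T :=
  TwoSidedIdeal.mem_mk' _ _ _ _ _ _ _

/-- The Calkin algebra of `H`: bounded operators modulo compact operators. -/
abbrev Calkin : Type _ := (compactIdeal H).ringCon.Quotient

/-- The quotient map onto the Calkin algebra. -/
def calkinMap : (H →L[ℂ] H) →+* Calkin H := (compactIdeal H).ringCon.mk'

theorem calkinMap_eq_zero {T : H →L[ℂ] H} : calkinMap H T = 0 ↔ IsCompactOperator T := by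
  rw [← mem_compactIdeal, TwoSidedIdeal.mem_iff]
  exact RingCon.eq _

variable [CompleteSpace H]

variable {H} in
theorem isCompactOperator_adjoint {T : H →L[ℂ] H} (hT : IsCompactOperator T) :
    IsCompactOperator (ContinuousLinearMap.adjoint T) := by
  set A := ContinuousLinearMap.adjoint T with hA
  have hTA : IsCompactOperator (T ∘L A) := hT.comp_clm A
  have hK := hTA.isCompact_closure_image_ball (f := (T ∘L A).toLinearMap) 1
  refine (isCompactOperator_iff_isCompact_closure_image_ball
    (f := A.toLinearMap) one_pos).2 ?_
  have htb : TotallyBounded ((T ∘L A) '' Metric.ball 0 1) :=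
    hK.totallyBounded.subset subset_closure
  refine isCompact_iff_totallyBounded_isComplete.2
    ⟨TotallyBounded.closure ?_, isClosed_closure.isComplete⟩
  rw [Metric.totallyBounded_iff]
  intro ε hε
  have hδ : 0 < ε ^ 2 / 4 := by positivity
  obtain ⟨t, hts, htf, ht⟩ := htb.exists_subset (Metric.dist_mem_uniformity hδ)
  have hts' : ∀ y ∈ t, ∃ x : H, x ∈ Metric.ball (0 : H) 1 ∧ T (A x) = y := fun y hy => hts hy
  choose! g hg hgt using hts'
  refine ⟨A '' (g '' t), (htf.image g).image A, ?_⟩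
  rintro _ ⟨x, hx, rfl⟩
  obtain ⟨y, hy, hxy⟩ := Set.mem_iUnion₂.1 (ht ⟨x, hx, rfl⟩)
  refine Set.mem_iUnion₂.2 ⟨A (g y), ⟨g y, ⟨y, hy, rfl⟩, rfl⟩, ?_⟩
  have h1 : ‖T (A (x - g y))‖ < ε ^ 2 / 4 := by
    have h : dist (T (A x)) y < ε ^ 2 / 4 := hxy
    have h' : T (A (g y)) = y := hgt y hy
    rw [map_sub, map_sub, h', ← dist_eq_norm]
    exact h
  have h2 : ‖x - g y‖ < 2 := by
    have hx' : ‖x‖ < 1 := by simpa using hx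
    have hy' : ‖g y‖ < 1 := by simpa using hg y hy
    linarith [norm_sub_le x (g y)]
  have h3 : ‖A (x - g y)‖ ^ 2 ≤ ‖T (A (x - g y))‖ * ‖x - g y‖ := by
    have h := ContinuousLinearMap.adjoint_inner_right T (A (x - g y)) (x - g y)
    rw [← hA, inner_self_eq_norm_sq_to_K] at h
    calc ‖A (x - g y)‖ ^ 2 = ‖((‖A (x - g y)‖ : ℂ)) ^ 2‖ := by simp
      _ = ‖inner ℂ (T (A (x - g y))) (x - g y)‖ := by rw [← h]; rfl
      _ ≤ _ := norm_inner_le_norm _ _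
  change dist (A x) (A (g y)) < ε
  rw [dist_eq_norm, ← map_sub]
  have h4 : ‖A (x - g y)‖ ^ 2 < ε ^ 2 := by
    nlinarith [norm_nonneg (T (A (x - g y))), norm_nonneg (x - g y)]
  exact lt_of_pow_lt_pow_left₀ 2 hε.le h4

/-- The involution of the Calkin algebra, induced by the adjoint. -/
instance calkinStar : Star (Calkin H) where
  star := Quotient.map' star fun S T h => by
    have h1 : S - T ∈ compactIdeal H := TwoSidedIdeal.rel_iff _ _ _ |>.1 h
    rw [mem_compactIdeal] at h1
    refine (TwoSidedIdeal.rel_iff _ _ _).2 ?_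
    rw [← star_sub, mem_compactIdeal]
    exact isCompactOperator_adjoint h1

theorem star_calkinMap (T : H →L[ℂ] H) : star (calkinMap H T) = calkinMap H (star T) := rfl

end Calkin

/-- The algebra `B_cc` of bounded operators on `L²` that commute with `P_+` up to a compact
operator. -/
def Bcc : Set (L2 →L[ℂ] L2) := {T | IsCompactOperator (T * Pplus - Pplus * T)}

/-- The essential class `E₁`: the orthogonal projections `P` in `B_cc` whose image in the Calkin
algebra has, with respect to the decomposition `1 = π(P_+) + π(P_-)`, the matrix with upper left
entry `p` and all other entries `0`, where `p` is a projection of the corner algebra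
`π(P_+) (B/K) π(P_+)` different from `0` and from its unit `π(P_+)`. -/
def EssE1 : Set (L2 →L[ℂ] L2) :=
  {P | IsStarProjection P ∧ P ∈ Bcc ∧
    ∃ p : Calkin L2, IsStarProjection p ∧
      calkinMap L2 Pplus * p * calkinMap L2 Pplus = p ∧ p ≠ 0 ∧ p ≠ calkinMap L2 Pplus ∧
      calkinMap L2 (Pplus * P * Pplus) = p ∧
      calkinMap L2 (Pplus * P * Pminus) = 0 ∧
      calkinMap L2 (Pminus * P * Pplus) = 0 ∧
      calkinMap L2 (Pminus * P * Pminus) = 0}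

end HardySpace

end

/-! Everything reduces to the codimension of `φ H²` in `H²`. Because `φ H² ⊆ H²`, the map `P_+`
restricted to `φ H²` is the inclusion: it is injective with cokernel `H² / φ H²`, and `P_-` vanishes
there. So membership in the Grassmannian means finite codimension, the index being minus the
codimension (`innerProj_mem_GrRes_iff`). In the Calkin algebra `P_φ` lives in the upper left corner
and is never zero; it equals `π(P_+)` exactly when the projection `P_+ - P_φ` onto the model space
`H² ⊖ φ H²` is compact, that is, has finite rank (`innerProj_mem_EssE1_iff`).

What remains is that codimension `n` characterizes Blaschke products with `n` factors
(`isBlaschkeOfDegree_iff_rank`), by induction on `n`. Each factor `b_a` accounts for one dimension,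
since `b_a H²` is the kernel of evaluation at `a`. To split off a factor, a zero of `φ` is needed:
on a nonzero finite-dimensional model space the backward shift has an eigenvector, which is a Szegő
kernel, and its orthogonality to `φ` is a zero of `φ` (`exists_diskExt_eq_zero`). Codimension zero
leaves only constants. -/

noncomputable section

namespace HardySpace

/-! ### Fourier coefficients and the holomorphic extension. -/

/-- The `n`-th Fourier coefficient of an element of `L²`. -/
abbrev coeff (f : L2) (n : ℤ) : ℂ := fourierCoeff (f : Circ → ℂ) n

theorem coeff_eq_inner (f : L2) (n : ℤ) :
    coeff f n = inner ℂ (fourierBasis (T := 2 * Real.pi) n) f := by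
  rw [coeff, ← fourierBasis_repr, HilbertBasis.repr_apply_apply]

theorem coeff_ext {f g : L2} (h : ∀ n, coeff f n = coeff g n) : f = g := by
  apply (fourierBasis (T := 2 * Real.pi)).repr.injective
  ext n
  rw [fourierBasis_repr, fourierBasis_repr]
  exact h n

theorem norm_coeff_le (f : L2) (n : ℤ) : ‖coeff f n‖ ≤ ‖f‖ := by
  rw [coeff_eq_inner]
  refine (norm_inner_le_norm _ _).trans ?_
  rw [(fourierBasis (T := 2 * Real.pi)).orthonormal.1 n, one_mul]

theorem integrable_coe (f : L2) : Integrable (f : Circ → ℂ) arc :=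
  (Lp.memLp f).integrable (by norm_num)

theorem fourierCoeff_fourier_one_mul (f : Circ → ℂ) (n : ℤ) :
    fourierCoeff (fun t => fourier 1 t * f t) n = fourierCoeff f (n - 1) := by
  unfold fourierCoeff
  congr 1
  ext t
  rw [smul_eq_mul, smul_eq_mul, ← mul_assoc, ← fourier_add]
  congr 3
  ring

theorem fourierCoeff_affine_mul (f : L2) (α β : ℂ) (n : ℤ) :
    fourierCoeff (fun t => (α * fourier 1 t + β) * f t) n
      = α * coeff f (n - 1) + β * coeff f n := by
  have hi : Integrable (fun t => fourier 1 t * f t) arc := by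
    refine (integrable_coe f).bdd_mul (c := 1) ?_ ?_
    · exact (fourier 1).continuous.aestronglyMeasurable
    · exact Eventually.of_forall fun t => (Circle.norm_coe _).le
  have h : (fun t => (α * fourier 1 t + β) * f t)
      = (fun t => α * (fourier 1 t * f t)) + fun t => β * f t := by
    ext t; simp only [Pi.add_apply]; ring
  rw [h, fourierCoeff.add (hi.const_mul α) ((integrable_coe f).const_mul β), Pi.add_apply,
    fourierCoeff.const_mul, fourierCoeff.const_mul, fourierCoeff_fourier_one_mul]

/-- Relations `f = b_a g` are used with the denominator cleared, so both multipliers are affine in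
`e^{it}` and the coefficients obey a two-term recursion. -/
theorem coeff_affine_eq {f g : L2} {α β γ δ : ℂ}
    (h : ∀ᵐ t ∂arc, (α * fourier 1 t + β) * f t = (γ * fourier 1 t + δ) * g t) (n : ℤ) :
    α * coeff f (n - 1) + β * coeff f n = γ * coeff g (n - 1) + δ * coeff g n := by
  rw [← fourierCoeff_affine_mul, ← fourierCoeff_affine_mul, fourierCoeff_congr_ae h]

theorem summable_coeff_mul_pow (f : L2) {z : ℂ} (hz : ‖z‖ < 1) :
    Summable fun n : ℕ => coeff f n * z ^ n := by
  refine Summable.of_norm_bounded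
    ((summable_geometric_of_lt_one (norm_nonneg z) hz).mul_left ‖f‖) fun n => ?_
  rw [norm_mul, norm_pow]
  gcongr
  exact norm_coeff_le f n

theorem hasSum_diskExt (f : L2) {z : ℂ} (hz : ‖z‖ < 1) :
    HasSum (fun n : ℕ => coeff f n * z ^ n) (diskExt f z) :=
  (summable_coeff_mul_pow f hz).hasSum

theorem hasSum_diskExt_affine {f : L2} (hf : f ∈ H2) (α β : ℂ) {z : ℂ} (hz : ‖z‖ < 1) :
    HasSum (fun n : ℕ => (α * coeff f ((n : ℤ) - 1) + β * coeff f n) * z ^ n)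
      ((α * z + β) * diskExt f z) := by
  have h1 : HasSum (fun n : ℕ => coeff f ((n : ℤ) - 1) * z ^ n) (z * diskExt f z) := by
    rw [← hasSum_nat_add_iff' 1]
    simp only [Finset.range_one, Finset.sum_singleton, Nat.cast_zero, zero_sub]
    -- The shifted series starts with the coefficient of index `-1`, which is zero for `f ∈ H²`.
    rw [coeff, mem_H2.1 hf (-1) (by norm_num), zero_mul, sub_zero]
    refine ((hasSum_diskExt f hz).mul_left z).congr_fun fun n => ?_
    rw [Nat.cast_add, Nat.cast_one, add_sub_cancel_right]
    ring
  rw [show (α * z + β) * diskExt f z = α * (z * diskExt f z) + β * diskExt f z by ring]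
  exact ((h1.mul_left α).add ((hasSum_diskExt f hz).mul_left β)).congr_fun fun n => by ring

theorem diskExt_affine_eq {f g : L2} (hf : f ∈ H2) (hg : g ∈ H2) {α β γ δ : ℂ}
    (h : ∀ᵐ t ∂arc, (α * fourier 1 t + β) * f t = (γ * fourier 1 t + δ) * g t)
    {z : ℂ} (hz : ‖z‖ < 1) :
    (α * z + β) * diskExt f z = (γ * z + δ) * diskExt g z := by
  refine (hasSum_diskExt_affine hf α β hz).unique ?_
  simp only [coeff_affine_eq h]
  exact hasSum_diskExt_affine hg γ δ hz

/-! ### Multiplication by an inner function on `H²`. -/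

/-- The monomial `e_n` as an element of `L²`. -/
def mono (n : ℤ) : L2 := fourierBasis (T := 2 * Real.pi) n

theorem coeFn_mono (n : ℤ) : (mono n : Circ → ℂ) =ᵐ[arc] fourier n := by
  rw [mono, coe_fourierBasis]
  exact coeFn_fourierLp 2 n

theorem coeff_mono (m n : ℤ) : coeff (mono m) n = if n = m then 1 else 0 := by
  rw [coeff_eq_inner, mono,
    orthonormal_iff_ite.1 (fourierBasis (T := 2 * Real.pi)).orthonormal]

theorem mono_mem_H2 {n : ℤ} (hn : 0 ≤ n) : mono n ∈ H2 := fun m hm => by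
  rw [← coeff, coeff_mono, if_neg (by omega)]

theorem hasSum_conj_coeff_mul_coeff (f g : L2) :
    HasSum (fun n : ℤ => conj (coeff f n) * coeff g n) (inner ℂ f g) := by
  simpa only [coeff_eq_inner, inner_conj_symm] using
    (fourierBasis (T := 2 * Real.pi)).hasSum_inner_mul_inner f g

theorem tendsto_coeff_atTop (f : L2) : Tendsto (fun n : ℕ => coeff f n) atTop (𝓝 0) := by
  have h := (hasSum_sq_fourierCoeff f).summable.tendsto_cofinite_zero
  have h2 := h.comp (Nat.cast_injective (R := ℤ)).tendsto_cofinite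
  rw [Nat.cofinite_eq_atTop] at h2
  rw [tendsto_zero_iff_norm_tendsto_zero]
  have := h2.sqrt
  simpa [Function.comp_def] using this

theorem coeff_mulOp (φ : L2) (hφ : IsInner φ) (f : L2) (n : ℤ) :
    HasSum (fun m : ℤ => coeff φ (n - m) * coeff f m) (coeff (mulOp φ hφ f) n) := by
  -- Pairing `f` with `e_n · conj φ` gives the `n`-th coefficient of `φ f`, so Parseval yields the
  -- convolution formula.
  have hmem : MemLp (fun t => fourier n t * conj (φ t)) 2 arc := by
    refine (Lp.memLp φ).of_le ?_ (Eventually.of_forall fun t => ?_)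
    swap
    · rw [norm_mul, RCLike.norm_conj, fourier_apply, Circle.norm_coe, one_mul]
    exact (fourier n).continuous.aestronglyMeasurable.mul
      (Complex.continuous_conj.comp_aestronglyMeasurable (Lp.aestronglyMeasurable φ))
  have hg := hmem.coeFn_toLp
  set g : L2 := hmem.toLp _ with hgdef
  have h1 : inner ℂ g f = coeff (mulOp φ hφ f) n := by
    rw [L2.inner_def, coeff, fourierCoeff]
    apply integral_congr_ae
    filter_upwards [hg, mulOp_coeFn φ hφ f] with t ht ht'
    rw [ht, ht', RCLike.inner_apply, map_mul, Complex.conj_conj, fourier_neg, smul_eq_mul]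
    ring
  have h2 : ∀ m, conj (coeff g m) = coeff φ (n - m) := fun m => by
    rw [coeff, fourierCoeff_congr_ae hg, coeff, fourierCoeff, fourierCoeff, ← integral_conj]
    congr 1
    ext t
    rw [smul_eq_mul, smul_eq_mul, map_mul, map_mul, Complex.conj_conj, fourier_neg,
      Complex.conj_conj, ← fourier_neg, ← mul_assoc, ← fourier_add]
    congr 3
    ring
  rw [← h1]
  simpa only [h2] using hasSum_conj_coeff_mul_coeff g f

theorem mulOp_mem_H2 {φ : L2} (hφ : IsInner φ) {f : L2} (hf : f ∈ H2) : mulOp φ hφ f ∈ H2 := by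
  intro n hn
  refine (coeff_mulOp φ hφ f n).unique ?_
  convert hasSum_zero with m
  rcases lt_or_ge m 0 with hm | hm
  · rw [coeff, coeff, mem_H2.1 hf m hm, mul_zero]
  · rw [coeff, coeff, mem_H2.1 hφ.mem_H2 (n - m) (by omega), zero_mul]

/-- The analytic Toeplitz operator `f ↦ φ f` on `H²` with inner symbol `φ`. -/
def toep (φ : L2) (hφ : IsInner φ) : H2 →L[ℂ] H2 :=
  ((mulOp φ hφ).toContinuousLinearMap ∘L H2.subtypeL).codRestrict H2
    fun f => mulOp_mem_H2 hφ f.2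

theorem coe_toep (φ : L2) (hφ : IsInner φ) (f : H2) : (toep φ hφ f : L2) = mulOp φ hφ f := rfl

theorem coeFn_toep (φ : L2) (hφ : IsInner φ) (f : H2) :
    ((toep φ hφ f : L2) : Circ → ℂ) =ᵐ[arc] fun t => φ t * (f : L2) t :=
  mulOp_coeFn φ hφ f

theorem toep_injective (φ : L2) (hφ : IsInner φ) : Function.Injective (toep φ hφ) := fun _ _ h =>
  Subtype.ext ((mulOp φ hφ).injective (congrArg Subtype.val h))

theorem mem_range_toep {φ : L2} {hφ : IsInner φ} {f : H2} :
    f ∈ (toep φ hφ).range ↔ (f : L2) ∈ mulH2 φ hφ := by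
  constructor
  · rintro ⟨g, rfl⟩
    exact ⟨g, g.2, rfl⟩
  · rintro ⟨g, hg, h⟩
    exact ⟨⟨g, hg⟩, Subtype.ext h⟩

theorem mulH2_le (φ : L2) (hφ : IsInner φ) : mulH2 φ hφ ≤ H2 := by
  rintro _ ⟨g, hg, rfl⟩
  exact mulOp_mem_H2 hφ hg

/-! ### Blaschke factors and division by them. -/

/-- The unimodular constant in front of the Blaschke factor `b_a`. -/
def blaschkeConst (a : ℂ) : ℂ := if a = 0 then -1 else conj a / (‖a‖ : ℂ)

theorem norm_blaschkeConst (a : ℂ) : ‖blaschkeConst a‖ = 1 := by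
  unfold blaschkeConst
  split_ifs with h
  · simp
  · rw [norm_div, RCLike.norm_conj, Complex.norm_real, norm_norm, div_self (norm_ne_zero_iff.2 h)]

theorem blaschkeConst_ne_zero (a : ℂ) : blaschkeConst a ≠ 0 :=
  norm_ne_zero_iff.1 (by rw [norm_blaschkeConst]; exact one_ne_zero)

/-- The value `-1` of `blaschkeConst` at `0` absorbs the sign in `b_0(z) = z = -(0 - z)`, so one
formula covers all `a`. -/
theorem blaschkeFactor_eq (a z : ℂ) :
    blaschkeFactor a z = blaschkeConst a * ((a - z) / (1 - conj a * z)) := by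
  unfold blaschkeFactor blaschkeConst
  split_ifs with h
  · simp [h]
  · rfl

theorem one_sub_conj_mul_ne_zero {a z : ℂ} (ha : ‖a‖ < 1) (hz : ‖z‖ ≤ 1) :
    1 - conj a * z ≠ 0 := by
  intro h
  have h1 : ‖conj a * z‖ = 1 := by rw [← sub_eq_zero.1 h, norm_one]
  rw [norm_mul, RCLike.norm_conj] at h1
  nlinarith [norm_nonneg a, norm_nonneg z]

theorem one_sub_mul_blaschkeFactor {a z : ℂ} (ha : ‖a‖ < 1) (hz : ‖z‖ ≤ 1) :
    (1 - conj a * z) * blaschkeFactor a z = blaschkeConst a * (a - z) := by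
  rw [blaschkeFactor_eq, mul_left_comm, mul_div_cancel₀ _ (one_sub_conj_mul_ne_zero ha hz)]

theorem norm_blaschkeFactor {a z : ℂ} (ha : ‖a‖ < 1) (hz : ‖z‖ = 1) :
    ‖blaschkeFactor a z‖ = 1 := by
  rw [blaschkeFactor_eq, norm_mul, norm_blaschkeConst, one_mul, norm_div]
  have h : ‖1 - conj a * z‖ = ‖a - z‖ := by
    have hzz : z * conj z = 1 := by rw [Complex.mul_conj']; simp [hz]
    calc ‖1 - conj a * z‖ = ‖z * conj (z - a)‖ := by
          rw [map_sub, mul_sub, hzz, mul_comm z]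
      _ = ‖a - z‖ := by rw [norm_mul, RCLike.norm_conj, hz, one_mul, norm_sub_rev]
  rw [← h, div_self (norm_ne_zero_iff.2 (one_sub_conj_mul_ne_zero ha hz.le))]

theorem norm_fourier (n : ℤ) (t : Circ) : ‖fourier n t‖ = 1 := Circle.norm_coe _

theorem measurable_blaschkeFactor (a : ℂ) :
    Measurable fun t : Circ => blaschkeFactor a (fourier 1 t) := by
  have h : Measurable (fourier (T := 2 * Real.pi) 1) := (fourier 1).continuous.measurable
  simp only [blaschkeFactor_eq]
  fun_prop

theorem memLp_blaschkeFactor {a : ℂ} (ha : ‖a‖ < 1) :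
    MemLp (fun t : Circ => blaschkeFactor a (fourier 1 t)) 2 arc :=
  MemLp.of_bound (measurable_blaschkeFactor a).aestronglyMeasurable 1
    (Eventually.of_forall fun t => (norm_blaschkeFactor ha (norm_fourier 1 t)).le)

/-- The boundary function of a Blaschke factor. -/
def blaschke (a : ℂ) (ha : ‖a‖ < 1) : L2 := (memLp_blaschkeFactor ha).toLp _

theorem coeFn_blaschke (a : ℂ) (ha : ‖a‖ < 1) :
    (blaschke a ha : Circ → ℂ) =ᵐ[arc] fun t => blaschkeFactor a (fourier 1 t) :=
  (memLp_blaschkeFactor ha).coeFn_toLp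

theorem blaschke_mul_affine {a : ℂ} (ha : ‖a‖ < 1) {f g : L2}
    (h : (f : Circ → ℂ) =ᵐ[arc] fun t => blaschkeFactor a (fourier 1 t) * g t) :
    ∀ᵐ t ∂arc, (-conj a * fourier 1 t + 1) * f t
      = (-blaschkeConst a * fourier 1 t + blaschkeConst a * a) * g t := by
  filter_upwards [h] with t ht
  have := one_sub_mul_blaschkeFactor ha (norm_fourier 1 t).le
  rw [ht]
  linear_combination g t * this

theorem isInner_blaschke (a : ℂ) (ha : ‖a‖ < 1) : IsInner (blaschke a ha) where
  norm_eq_one := by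
    filter_upwards [coeFn_blaschke a ha] with t ht
    rw [ht, norm_blaschkeFactor ha (norm_fourier 1 t)]
  mem_H2 := by
    have h : (blaschke a ha : Circ → ℂ) =ᵐ[arc]
        fun t => blaschkeFactor a (fourier 1 t) * mono 0 t := by
      filter_upwards [coeFn_blaschke a ha, coeFn_mono 0] with t ht ht'
      rw [ht, ht', fourier_zero, mul_one]
    -- A nonzero coefficient of negative index would force growth like `|a|^{-m}` towards `-∞`, but
    -- coefficients are bounded by the norm.
    have hrec : ∀ n : ℤ, n < 0 →
        coeff (blaschke a ha) n = conj a * coeff (blaschke a ha) (n - 1) := fun n hn => by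
      have h1 := coeff_affine_eq (blaschke_mul_affine ha h) n
      rw [coeff_mono, coeff_mono, if_neg (by omega), if_neg (by omega)] at h1
      linear_combination h1
    intro n hn
    have hpow : ∀ m : ℕ, coeff (blaschke a ha) n
        = conj a ^ m * coeff (blaschke a ha) (n - m) := fun m => by
      induction m with
      | zero => simp
      | succ m ih =>
        rw [ih, hrec (n - m) (by omega), pow_succ, Nat.cast_succ, mul_assoc, sub_sub]
    have hle : ∀ m : ℕ, ‖coeff (blaschke a ha) n‖ ≤ ‖a‖ ^ m * ‖blaschke a ha‖ := fun m => by
      rw [hpow m, norm_mul, norm_pow, RCLike.norm_conj]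
      gcongr
      exact norm_coeff_le _ _
    have hlim := (tendsto_pow_atTop_nhds_zero_of_lt_one (norm_nonneg a) ha).mul_const
      ‖blaschke a ha‖
    rw [zero_mul] at hlim
    exact norm_le_zero_iff.1 (ge_of_tendsto' hlim hle)

theorem diskExt_blaschke_mul {a : ℂ} (ha : ‖a‖ < 1) {f g : L2} (hf : f ∈ H2) (hg : g ∈ H2)
    (h : (f : Circ → ℂ) =ᵐ[arc] fun t => blaschkeFactor a (fourier 1 t) * g t)
    {z : ℂ} (hz : ‖z‖ < 1) :
    diskExt f z = blaschkeFactor a z * diskExt g z := by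
  have h1 := diskExt_affine_eq hf hg (blaschke_mul_affine ha h) hz
  apply mul_left_cancel₀ (one_sub_conj_mul_ne_zero ha hz.le)
  rw [← mul_assoc, one_sub_mul_blaschkeFactor ha hz.le]
  linear_combination h1

/-- A function in `H²` vanishing at `a` is divisible by the Blaschke factor `b_a` in `H²`. -/
theorem mem_H2_of_blaschke_mul {a : ℂ} (ha : ‖a‖ < 1) {f g : L2} (hf : f ∈ H2)
    (h : (f : Circ → ℂ) =ᵐ[arc] fun t => blaschkeFactor a (fourier 1 t) * g t)
    (hz : diskExt f a = 0) : g ∈ H2 := by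
  have hrec := coeff_affine_eq (blaschke_mul_affine ha h)
  have hκ := blaschkeConst_ne_zero a
  set κ := blaschkeConst a
  have hneg : ∀ n : ℤ, n < 0 → coeff g (n - 1) = a * coeff g n := fun n hn => by
    have h1 := hrec n
    rw [coeff, coeff, mem_H2.1 hf n hn, mem_H2.1 hf (n - 1) (by omega)] at h1
    apply mul_left_cancel₀ hκ
    linear_combination h1
  have hsum := (hasSum_diskExt_affine hf (-conj a) 1 ha).tendsto_sum_nat
  rw [hz, mul_zero] at hsum
  -- Weighted by `a ^ n`, the recursion telescopes. The left side sums to `(1 - |a|²) f(a) = 0`,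
  -- which leaves `coeff g (-1) = 0`; `hneg` then propagates this to all negative indices.
  have htel : ∀ N : ℕ, ∑ n ∈ Finset.range N,
      (-conj a * coeff f ((n : ℤ) - 1) + 1 * coeff f n) * a ^ n
      = κ * (a ^ N * coeff g ((N : ℤ) - 1) - coeff g (-1)) := fun N => by
    induction N with
    | zero => simp
    | succ N ih =>
      rw [Finset.sum_range_succ, ih, hrec, Nat.cast_succ, add_sub_cancel_right]
      ring
  simp only [htel] at hsum
  have hlim : Tendsto (fun N : ℕ => a ^ N * coeff g ((N : ℤ) - 1)) atTop (𝓝 0) := by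
    apply squeeze_zero_norm (a := fun N : ℕ => ‖a‖ ^ N * ‖g‖)
    · intro N
      rw [norm_mul, norm_pow]
      gcongr
      exact norm_coeff_le _ _
    · simpa using (tendsto_pow_atTop_nhds_zero_of_lt_one (norm_nonneg a) ha).mul_const ‖g‖
  have h0 := tendsto_nhds_unique hsum ((hlim.sub_const (coeff g (-1))).const_mul κ)
  have hm1 : coeff g (-1) = 0 := by simpa [hκ] using h0.symm
  have hall : ∀ m : ℕ, coeff g (-1 - m) = 0 := fun m => by
    induction m with
    | zero => simpa using hm1
    | succ m ih =>
      rw [Nat.cast_succ, ← sub_sub, hneg _ (by omega), ih, mul_zero]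
  intro n hn
  have := hall (-1 - n).toNat
  rwa [Int.toNat_of_nonneg (by omega), sub_sub_cancel] at this

theorem exists_blaschke_mul {a : ℂ} (ha : ‖a‖ < 1) {f : L2} (hf : f ∈ H2)
    (hz : diskExt f a = 0) :
    ∃ g ∈ H2, (f : Circ → ℂ) =ᵐ[arc] fun t => blaschkeFactor a (fourier 1 t) * g t := by
  have hmem : MemLp (fun t => conj (blaschkeFactor a (fourier 1 t)) * f t) 2 arc := by
    refine (Lp.memLp f).of_le ?_ (Eventually.of_forall fun t => ?_)
    · exact (Complex.continuous_conj.measurable.comp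
        (measurable_blaschkeFactor a)).aestronglyMeasurable.mul (Lp.aestronglyMeasurable f)
    · rw [norm_mul, RCLike.norm_conj, norm_blaschkeFactor ha (norm_fourier 1 t), one_mul]
  have h : (f : Circ → ℂ) =ᵐ[arc]
      fun t => blaschkeFactor a (fourier 1 t) * hmem.toLp _ t := by
    filter_upwards [hmem.coeFn_toLp] with t ht
    rw [ht, ← mul_assoc, Complex.mul_conj', norm_blaschkeFactor ha (norm_fourier 1 t)]
    simp
  exact ⟨hmem.toLp _, mem_H2_of_blaschke_mul ha hf h hz, h⟩

theorem exists_isInner_blaschke_mul {a : ℂ} (ha : ‖a‖ < 1) {φ : L2} (hφ : IsInner φ)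
    (hz : diskExt φ a = 0) :
    ∃ ψ : L2, IsInner ψ ∧
      (φ : Circ → ℂ) =ᵐ[arc] fun t => blaschkeFactor a (fourier 1 t) * ψ t := by
  obtain ⟨ψ, hψ, h⟩ := exists_blaschke_mul ha hφ.mem_H2 hz
  refine ⟨ψ, ⟨hψ, ?_⟩, h⟩
  filter_upwards [h, hφ.norm_eq_one] with t ht ht'
  rwa [ht, norm_mul, norm_blaschkeFactor ha (norm_fourier 1 t), one_mul] at ht'

/-! ### Codimension of the range and its additivity. -/

/-- Evaluation of the holomorphic extension at a point of the disk. -/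
def evalAt (a : ℂ) (ha : ‖a‖ < 1) : H2 →ₗ[ℂ] ℂ where
  toFun f := diskExt f a
  map_add' f g := by
    refine (hasSum_diskExt _ ha).unique ?_
    refine ((hasSum_diskExt (f : L2) ha).add (hasSum_diskExt (g : L2) ha)).congr_fun fun n => ?_
    rw [Submodule.coe_add, coeff_eq_inner, inner_add_right, ← coeff_eq_inner, ← coeff_eq_inner,
      add_mul]
  map_smul' c f := by
    refine (hasSum_diskExt _ ha).unique ?_
    refine ((hasSum_diskExt (f : L2) ha).mul_left c).congr_fun fun n => ?_
    rw [Submodule.coe_smul, coeff_eq_inner, inner_smul_right, ← coeff_eq_inner, mul_assoc]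

theorem evalAt_mono_zero (a : ℂ) (ha : ‖a‖ < 1) :
    evalAt a ha ⟨mono 0, mono_mem_H2 le_rfl⟩ = 1 := by
  refine (hasSum_diskExt _ ha).unique ?_
  convert hasSum_ite_eq (0 : ℕ) (1 : ℂ) using 2 with n
  rw [coeff_mono]
  rcases eq_or_ne n 0 with rfl | hn
  · simp
  · simp [hn]

theorem evalAt_surjective (a : ℂ) (ha : ‖a‖ < 1) : Function.Surjective (evalAt a ha) := fun c =>
  ⟨c • ⟨mono 0, mono_mem_H2 le_rfl⟩, by
    rw [map_smul, evalAt_mono_zero, smul_eq_mul, mul_one]⟩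

theorem range_toep_blaschke (a : ℂ) (ha : ‖a‖ < 1) :
    (toep (blaschke a ha) (isInner_blaschke a ha)).range = LinearMap.ker (evalAt a ha) := by
  have key : ∀ g : H2, ((toep (blaschke a ha) (isInner_blaschke a ha) g : L2) : Circ → ℂ)
      =ᵐ[arc] fun t => blaschkeFactor a (fourier 1 t) * (g : L2) t := fun g => by
    filter_upwards [coeFn_toep _ (isInner_blaschke a ha) g, coeFn_blaschke a ha] with t ht ht'
    rw [ht, ht']
  ext f
  constructor
  · rintro ⟨g, rfl⟩
    rw [LinearMap.mem_ker]
    refine (diskExt_blaschke_mul ha (Subtype.prop _) g.2 (key g) ha).trans ?_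
    rw [blaschkeFactor_eq, sub_self, zero_div, mul_zero, zero_mul]
  · intro hf
    obtain ⟨g, hg, h⟩ := exists_blaschke_mul ha f.2 hf
    refine ⟨⟨g, hg⟩, Subtype.ext (Lp.ext ?_)⟩
    exact (key ⟨g, hg⟩).trans h.symm

theorem rank_quotient_range_toep_blaschke (a : ℂ) (ha : ‖a‖ < 1) :
    Module.rank ℂ (H2 ⧸ (toep (blaschke a ha) (isInner_blaschke a ha)).range) = 1 := by
  rw [range_toep_blaschke,
    ((evalAt a ha).quotKerEquivOfSurjective (evalAt_surjective a ha)).rank_eq]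
  exact Module.rank_self ℂ

/-- Exactness of `0 → V/ran S → V/ran TS → V/ran T → 0`, the first map being induced by `T`. Ranks
are cardinals, so no finiteness is needed and infinite codimension is not confused with `0`, as it
would be with `finrank`. -/
theorem rank_quotient_range_comp {V : Type*} [AddCommGroup V] [Module ℂ V] {T S : V →ₗ[ℂ] V}
    (hT : Function.Injective T) :
    Module.rank ℂ (V ⧸ LinearMap.range (T ∘ₗ S))
      = Module.rank ℂ (V ⧸ LinearMap.range T) + Module.rank ℂ (V ⧸ LinearMap.range S) := by
  have hle : LinearMap.range (T ∘ₗ S) ≤ LinearMap.range T := LinearMap.range_comp_le_range S T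
  have hle' : LinearMap.range S ≤ (LinearMap.range (T ∘ₗ S)).comap T := by
    rintro _ ⟨x, rfl⟩; exact ⟨x, rfl⟩
  set p := Submodule.factor hle
  set i := Submodule.mapQ _ _ T hle'
  have hi : Function.Injective i := by
    rw [← LinearMap.ker_eq_bot, LinearMap.ker_eq_bot']
    intro m hm
    obtain ⟨x, rfl⟩ := Submodule.mkQ_surjective _ m
    obtain ⟨y, hy⟩ := (Submodule.Quotient.mk_eq_zero _).1 hm
    exact (Submodule.Quotient.mk_eq_zero _).2 ⟨y, hT hy⟩
  have hpi : LinearMap.ker p = LinearMap.range i := by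
    ext m
    obtain ⟨x, rfl⟩ := Submodule.mkQ_surjective _ m
    constructor
    · intro h
      obtain ⟨y, rfl⟩ := (Submodule.Quotient.mk_eq_zero _).1 (LinearMap.mem_ker.1 h)
      exact ⟨Submodule.mkQ _ y, rfl⟩
    · rintro ⟨m', h⟩
      obtain ⟨y, rfl⟩ := Submodule.mkQ_surjective _ m'
      rw [← h]
      exact (Submodule.Quotient.mk_eq_zero _).2 ⟨y, rfl⟩
  have hp : Function.Surjective p := Submodule.factor_surjective hle
  rw [← LinearMap.rank_range_add_rank_ker p, LinearMap.range_eq_top.2 hp, rank_top, hpi,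
    (LinearEquiv.ofInjective i hi).rank_eq]

theorem rank_quotient_range_toep_mul {a : ℂ} (ha : ‖a‖ < 1) {φ ψ : L2} (hφ : IsInner φ)
    (hψ : IsInner ψ)
    (h : (φ : Circ → ℂ) =ᵐ[arc] fun t => blaschkeFactor a (fourier 1 t) * ψ t) :
    Module.rank ℂ (H2 ⧸ (toep φ hφ).range) = 1 + Module.rank ℂ (H2 ⧸ (toep ψ hψ).range) := by
  have hcomp : (toep φ hφ : H2 →ₗ[ℂ] H2)
      = (toep (blaschke a ha) (isInner_blaschke a ha) : H2 →ₗ[ℂ] H2) ∘ₗ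
        (toep ψ hψ : H2 →ₗ[ℂ] H2) := by
    ext1 f
    refine Subtype.ext (Lp.ext ?_)
    filter_upwards [h, coeFn_toep φ hφ f, coeFn_toep ψ hψ f, coeFn_blaschke a ha,
      coeFn_toep _ (isInner_blaschke a ha) (toep ψ hψ f)] with t h1 h2 h3 h4 h5
    refine h2.trans (Eq.trans ?_ h5.symm)
    rw [h1, h3, h4, mul_assoc]
  rw [hcomp, rank_quotient_range_comp (toep_injective _ _), rank_quotient_range_toep_blaschke]

/-! ### Uniqueness of the extension and Blaschke products of degree zero. -/

theorem continuousAt_diskExt (f : L2) {z : ℂ} (hz : ‖z‖ < 1) : ContinuousAt (diskExt f) z := by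
  obtain ⟨r, hzr, hr⟩ := exists_between hz
  have hr0 : 0 ≤ r := (norm_nonneg z).trans hzr.le
  have hc : ContinuousOn (diskExt f) (Metric.ball 0 r) := by
    refine continuousOn_tsum (u := fun n : ℕ => ‖f‖ * r ^ n) (fun n => by fun_prop)
      ((summable_geometric_of_lt_one hr0 hr).mul_left _) fun n w hw => ?_
    rw [norm_mul, norm_pow]
    gcongr
    · exact norm_coeff_le f n
    · exact (mem_ball_zero_iff.1 hw).le
  exact hc.continuousAt (Metric.isOpen_ball.mem_nhds (mem_ball_zero_iff.2 hzr))

theorem ball_mem_nhds_of_norm_lt_one {z : ℂ} (hz : ‖z‖ < 1) : ∀ᶠ w in 𝓝 z, ‖w‖ < 1 :=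
  (continuous_norm.tendsto z).eventually_lt_const hz

theorem hasFPowerSeriesAt_diskExt (f : L2) :
    HasFPowerSeriesAt (diskExt f)
      (FormalMultilinearSeries.ofScalars ℂ fun n : ℕ => coeff f n) 0 := by
  rw [hasFPowerSeriesAt_iff]
  filter_upwards [ball_mem_nhds_of_norm_lt_one (z := 0) (by simp)] with z hz
  rw [zero_add]
  refine (hasSum_diskExt f hz).congr_fun fun n => ?_
  rw [FormalMultilinearSeries.coeff_ofScalars, smul_eq_mul, mul_comm]

theorem eq_of_diskExt_eq {f g : L2} (hf : f ∈ H2) (hg : g ∈ H2)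
    (h : ∀ z : ℂ, ‖z‖ < 1 → diskExt f z = diskExt g z) : f = g := by
  have h1 := (hasFPowerSeriesAt_diskExt f).congr (g := diskExt g) (by
    filter_upwards [ball_mem_nhds_of_norm_lt_one (z := 0) (by simp)] with z hz using h z hz)
  have h2 := h1.eq_formalMultilinearSeries (hasFPowerSeriesAt_diskExt g)
  refine coeff_ext fun n => ?_
  rcases lt_or_ge n 0 with hn | hn
  · rw [coeff, coeff, mem_H2.1 hf n hn, mem_H2.1 hg n hn]
  · lift n to ℕ using hn
    have := congrArg (fun p => FormalMultilinearSeries.coeff p n) h2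
    simpa only [FormalMultilinearSeries.coeff_ofScalars] using this

/-- The holomorphic extension of `φ` is a unimodular constant times a product of `n` Blaschke
factors. -/
def IsBlaschkeOfDegree (φ : L2) (n : ℕ) : Prop :=
  ∃ (c : ℂ) (a : Fin n → ℂ), ‖c‖ = 1 ∧ (∀ j, ‖a j‖ < 1) ∧
    ∀ z : ℂ, ‖z‖ < 1 → diskExt φ z = c * ∏ j, blaschkeFactor (a j) z

theorem isFiniteBlaschke_iff {φ : L2} : IsFiniteBlaschke φ ↔ ∃ n, IsBlaschkeOfDegree φ n := by
  unfold IsFiniteBlaschke IsBlaschkeOfDegree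
  exact exists_comm

theorem ae_eq_const_of_eq_smul_mono {φ : L2} {c : ℂ} (h : φ = c • mono 0) :
    (φ : Circ → ℂ) =ᵐ[arc] fun _ => c := by
  rw [h]
  filter_upwards [Lp.coeFn_smul c (mono 0), coeFn_mono 0] with t h1 h2
  rw [h1, Pi.smul_apply, h2, fourier_zero, smul_eq_mul, mul_one]

theorem diskExt_smul_mono_zero (c : ℂ) {z : ℂ} (hz : ‖z‖ < 1) : diskExt (c • mono 0) z = c := by
  have h := (evalAt z hz).map_smul c ⟨mono 0, mono_mem_H2 le_rfl⟩
  rw [evalAt_mono_zero, smul_eq_mul, mul_one] at h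
  exact h

/-- If `φ H² = H²`, then `1 = φ f` with `f ∈ H²`, so `conj φ = f` almost everywhere. Both `φ` and
its conjugate have no negative coefficients, hence `φ` is constant. -/
theorem isBlaschkeOfDegree_zero_iff {φ : L2} (hφ : IsInner φ) :
    IsBlaschkeOfDegree φ 0 ↔ (toep φ hφ).range = ⊤ := by
  constructor
  · rintro ⟨c, a, hc, -, h⟩
    simp only [Finset.univ_eq_empty, Finset.prod_empty, mul_one] at h
    have hc0 : c ≠ 0 := norm_ne_zero_iff.1 (by rw [hc]; exact one_ne_zero)
    have hφc : φ = c • mono 0 :=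
      eq_of_diskExt_eq hφ.mem_H2 (H2.smul_mem c (mono_mem_H2 le_rfl)) fun z hz => by
        rw [h z hz, diskExt_smul_mono_zero c hz]
    rw [LinearMap.range_eq_top]
    intro f
    refine ⟨c⁻¹ • f, Subtype.ext (Lp.ext ?_)⟩
    filter_upwards [coeFn_toep φ hφ (c⁻¹ • f), ae_eq_const_of_eq_smul_mono hφc,
      Lp.coeFn_smul c⁻¹ (f : L2)] with t h1 h2 h3
    refine h1.trans ?_
    rw [h2, Submodule.coe_smul, h3, Pi.smul_apply, smul_eq_mul, mul_inv_cancel_left₀ hc0]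
  · intro h
    obtain ⟨f, hf⟩ := LinearMap.range_eq_top.1 h ⟨mono 0, mono_mem_H2 le_rfl⟩
    have hφf : ∀ᵐ t ∂arc, conj (φ t) = (f : L2) t := by
      have h1 := coeFn_toep φ hφ f
      have h2 : (toep φ hφ f : L2) = mono 0 := congrArg Subtype.val hf
      rw [h2] at h1
      filter_upwards [h1, coeFn_mono 0, hφ.norm_eq_one] with t h3 h4 h5
      rw [h4, fourier_zero] at h3
      rw [← mul_one (conj (φ t)), h3, ← mul_assoc, Complex.conj_mul', h5]
      simp
    have hpos : ∀ n : ℤ, 0 < n → coeff φ n = 0 := fun n hn => by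
      have h1 : conj (coeff φ n) = coeff (f : L2) (-n) := by
        rw [coeff, coeff, ← fourierCoeff_congr_ae hφf, fourierCoeff, fourierCoeff,
          ← integral_conj]
        congr 1
        ext t
        rw [smul_eq_mul, smul_eq_mul, map_mul, ← fourier_neg]
      rw [show coeff (f : L2) (-n) = 0 from mem_H2.1 f.2 (-n) (by omega)] at h1
      simpa using h1
    have hφc : φ = coeff φ 0 • mono 0 := coeff_ext fun n => by
      rw [coeff_eq_inner (_ • _), inner_smul_right, ← coeff_eq_inner, coeff_mono]
      rcases lt_trichotomy n 0 with hn | rfl | hn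
      · rw [if_neg hn.ne, mul_zero, coeff, mem_H2.1 hφ.mem_H2 n hn]
      · simp
      · rw [if_neg hn.ne', mul_zero, hpos n hn]
    refine ⟨coeff φ 0, Fin.elim0, ?_, fun j => j.elim0, fun z hz => ?_⟩
    · obtain ⟨t, h1, h2⟩ := ((ae_eq_const_of_eq_smul_mono hφc).and hφ.norm_eq_one).exists
      rwa [h1] at h2
    · conv_lhs => rw [hφc]
      rw [diskExt_smul_mono_zero _ hz]
      simp

/-! ### Zeros of Blaschke products, with multiplicity. -/

theorem analyticAt_blaschkeFactor {a z : ℂ} (ha : ‖a‖ < 1) (hz : ‖z‖ < 1) :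
    AnalyticAt ℂ (blaschkeFactor a) z := by
  have h : blaschkeFactor a = fun z => blaschkeConst a * ((a - z) / (1 - conj a * z)) :=
    funext (blaschkeFactor_eq a)
  have h0 := one_sub_conj_mul_ne_zero ha hz.le
  rw [h]
  fun_prop (disch := exact h0)

theorem blaschkeFactor_eq_zero_iff {a z : ℂ} (ha : ‖a‖ < 1) (hz : ‖z‖ < 1) :
    blaschkeFactor a z = 0 ↔ z = a := by
  rw [blaschkeFactor_eq, mul_eq_zero, div_eq_zero_iff, sub_eq_zero]
  simp [blaschkeConst_ne_zero, one_sub_conj_mul_ne_zero ha hz.le, eq_comm]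

/-- The factor cancels away from its only zero `a`; continuity recovers the value at `a`. -/
theorem diskExt_eq_of_blaschkeFactor_mul_eq {a : ℂ} (ha : ‖a‖ < 1) {f : L2} {F : ℂ → ℂ}
    (hF : ContinuousAt F a)
    (h : ∀ z : ℂ, ‖z‖ < 1 → blaschkeFactor a z * diskExt f z = blaschkeFactor a z * F z)
    {z : ℂ} (hz : ‖z‖ < 1) : diskExt f z = F z := by
  have hne : ∀ w : ℂ, ‖w‖ < 1 → w ≠ a → diskExt f w = F w := fun w hw hwa =>
    mul_left_cancel₀ (mt (blaschkeFactor_eq_zero_iff ha hw).1 hwa) (h w hw)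
  rcases eq_or_ne z a with rfl | hza
  · have hev : diskExt f =ᶠ[𝓝[≠] z] F := by
      filter_upwards [self_mem_nhdsWithin,
        mem_nhdsWithin_of_mem_nhds (ball_mem_nhds_of_norm_lt_one hz)] with w h1 h2
      exact hne w h2 h1
    exact tendsto_nhds_unique
      (((continuousAt_diskExt f hz).tendsto.mono_left nhdsWithin_le_nhds).congr' hev)
      (hF.tendsto.mono_left nhdsWithin_le_nhds)
  · exact hne z hz hza

theorem analyticOrderAt_blaschkeFactor {a z : ℂ} (ha : ‖a‖ < 1) (hz : ‖z‖ < 1) :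
    analyticOrderAt (blaschkeFactor a) z = if z = a then 1 else 0 := by
  have han := analyticAt_blaschkeFactor ha hz
  split_ifs with h
  · subst h
    have h0 := one_sub_conj_mul_ne_zero ha hz.le
    rw [← Nat.cast_one, han.analyticOrderAt_eq_natCast]
    refine ⟨fun w => -blaschkeConst z / (1 - conj z * w), by fun_prop (disch := exact h0),
      div_ne_zero (neg_ne_zero.2 (blaschkeConst_ne_zero z)) h0, Eventually.of_forall fun w => ?_⟩
    rw [blaschkeFactor_eq, smul_eq_mul, pow_one]
    ring
  · rw [han.analyticOrderAt_eq_zero, Ne, blaschkeFactor_eq_zero_iff ha hz]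
    exact h

theorem analyticOrderAt_prod {ι : Type*} (s : Finset ι) (F : ι → ℂ → ℂ) {z : ℂ}
    (hF : ∀ i ∈ s, AnalyticAt ℂ (F i) z) :
    analyticOrderAt (fun w => ∏ i ∈ s, F i w) z = ∑ i ∈ s, analyticOrderAt (F i) z := by
  classical
  induction s using Finset.induction_on with
  | empty => simp [analyticAt_const.analyticOrderAt_eq_zero]
  | insert i s hi ih =>
    have h1 := fun j hj => hF j (Finset.mem_insert_of_mem hj)
    rw [Finset.sum_insert hi, ← ih h1]
    simp only [Finset.prod_insert hi]
    exact analyticOrderAt_mul (hF i (Finset.mem_insert_self i s))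
      (Finset.analyticAt_fun_prod s h1)

theorem IsBlaschkeOfDegree.analyticOrderAt_diskExt {φ : L2} {c : ℂ} {n : ℕ} {a : Fin n → ℂ}
    (hc : ‖c‖ = 1) (ha : ∀ j, ‖a j‖ < 1)
    (h : ∀ z : ℂ, ‖z‖ < 1 → diskExt φ z = c * ∏ j, blaschkeFactor (a j) z)
    {z : ℂ} (hz : ‖z‖ < 1) :
    analyticOrderAt (diskExt φ) z = ∑ j, if z = a j then 1 else 0 := by
  have hc0 : c ≠ 0 := norm_ne_zero_iff.1 (by rw [hc]; exact one_ne_zero)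
  have hev : diskExt φ =ᶠ[𝓝 z] (fun _ => c) * fun w => ∏ j, blaschkeFactor (a j) w := by
    filter_upwards [ball_mem_nhds_of_norm_lt_one hz] with w hw using h w hw
  have han : ∀ j ∈ Finset.univ, AnalyticAt ℂ (blaschkeFactor (a j)) z :=
    fun j _ => analyticAt_blaschkeFactor (ha j) hz
  rw [analyticOrderAt_congr hev,
    analyticOrderAt_mul analyticAt_const (Finset.analyticAt_fun_prod _ han),
    analyticAt_const.analyticOrderAt_eq_zero.2 hc0, zero_add, analyticOrderAt_prod _ _ han]
  exact Finset.sum_congr rfl fun j _ => analyticOrderAt_blaschkeFactor (ha j) hz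

theorem IsBlaschkeOfDegree.numZeros_eq {φ : L2} {n : ℕ} (h : IsBlaschkeOfDegree φ n) :
    numZeros φ = n := by
  classical
  obtain ⟨c, a, hc, ha, h⟩ := h
  -- The orders over `s` add up to the number of indices `j` with `a j ∈ s`: at most `n`, attained
  -- at the set of all `a j`.
  have hsum : ∀ s : Finset (Metric.ball (0 : ℂ) 1),
      ∑ z ∈ s, analyticOrderAt (diskExt φ) (z : ℂ)
        = ∑ j, if (⟨a j, mem_ball_zero_iff.2 (ha j)⟩ : Metric.ball (0 : ℂ) 1) ∈ s
            then (1 : ℕ∞) else 0 := fun s => by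
    rw [Finset.sum_congr rfl fun z _ =>
      analyticOrderAt_diskExt hc ha h (mem_ball_zero_iff.1 z.2), Finset.sum_comm]
    refine Finset.sum_congr rfl fun j _ => ?_
    rw [← Finset.sum_ite_eq' s (⟨a j, mem_ball_zero_iff.2 (ha j)⟩ : Metric.ball (0 : ℂ) 1)
      fun _ => (1 : ℕ∞)]
    refine Finset.sum_congr rfl fun z _ => ?_
    simp only [Subtype.ext_iff]
  unfold numZeros
  apply le_antisymm
  · refine iSup_le fun s => ?_
    rw [hsum]
    refine (Finset.sum_le_sum (g := fun _ => (1 : ℕ∞)) fun j _ => ?_).trans (by simp)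
    split_ifs <;> simp
  · refine le_iSup_of_le
      (Finset.univ.image fun j => ⟨a j, mem_ball_zero_iff.2 (ha j)⟩) ?_
    rw [hsum]
    simp

/-! ### The model space, the backward shift and existence of a zero. -/

theorem isInner_mono {n : ℤ} (hn : 0 ≤ n) : IsInner (mono n) where
  mem_H2 := mono_mem_H2 hn
  norm_eq_one := by
    filter_upwards [coeFn_mono n] with t ht
    rw [ht, norm_fourier]

theorem mulOp_mono_mono {m : ℤ} (hm : 0 ≤ m) (n : ℤ) :
    mulOp (mono m) (isInner_mono hm) (mono n) = mono (m + n) := by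
  refine Lp.ext ?_
  filter_upwards [mulOp_coeFn (mono m) (isInner_mono hm) (mono n), coeFn_mono m, coeFn_mono n,
    coeFn_mono (m + n)] with t h1 h2 h3 h4
  rw [h1, h2, h3, h4, fourier_add]

theorem mulOp_comm {φ ψ : L2} (hφ : IsInner φ) (hψ : IsInner ψ) (f : L2) :
    mulOp φ hφ (mulOp ψ hψ f) = mulOp ψ hψ (mulOp φ hφ f) := by
  refine Lp.ext ?_
  filter_upwards [mulOp_coeFn φ hφ (mulOp ψ hψ f), mulOp_coeFn ψ hψ (mulOp φ hφ f),
    mulOp_coeFn φ hφ f, mulOp_coeFn ψ hψ f] with t h1 h2 h3 h4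
  rw [h1, h2, h3, h4, mul_left_comm]

theorem isClosed_mulH2 (φ : L2) (hφ : IsInner φ) : IsClosed (mulH2 φ hφ : Set L2) :=
  (mulOp φ hφ).isometry.isClosedEmbedding.isClosedMap _ isClosed_H2

theorem isClosed_range_toep (φ : L2) (hφ : IsInner φ) :
    IsClosed ((toep φ hφ).range : Set H2) := by
  have h : ((toep φ hφ).range : Set H2) = Subtype.val ⁻¹' (mulH2 φ hφ : Set L2) :=
    Set.ext fun f => mem_range_toep
  rw [h]
  exact (isClosed_mulH2 φ hφ).preimage continuous_subtype_val

instance completeSpace_range_toep (φ : L2) (hφ : IsInner φ) :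
    CompleteSpace (toep φ hφ).range :=
  (isClosed_range_toep φ hφ).completeSpace_coe

/-- The quotient `H² / φ H²` is isomorphic to the model space `H² ⊖ φ H²`. -/
def quotientEquivModel (φ : L2) (hφ : IsInner φ) :
    (H2 ⧸ (toep φ hφ).range) ≃ₗ[ℂ] ((toep φ hφ).range)ᗮ :=
  Submodule.quotientEquivOfIsCompl _ _ (Submodule.isCompl_orthogonal _)

/-- The unilateral shift on `H²`. -/
abbrev shift : H2 →L[ℂ] H2 := toep (mono 1) (isInner_mono zero_le_one)

theorem coeff_adjoint_shift (f : H2) (n : ℕ) :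
    coeff (ContinuousLinearMap.adjoint shift f : L2) n = coeff (f : L2) (n + 1) := by
  have h : ∀ (m : ℕ) (g : H2),
      coeff (g : L2) m = inner ℂ (⟨mono m, mono_mem_H2 (Int.natCast_nonneg m)⟩ : H2) g :=
    fun m g => coeff_eq_inner _ _
  rw [h, ContinuousLinearMap.adjoint_inner_right, ← Nat.cast_succ, h]
  congr 1
  refine Subtype.ext ?_
  rw [coe_toep, mulOp_mono_mono zero_le_one, add_comm]
  rfl

/-- The shift commutes with multiplication by `φ`, so it preserves `φ H²`, and its adjoint preserves
the orthogonal complement. -/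
theorem adjoint_shift_mem {φ : L2} (hφ : IsInner φ) {k : H2} (hk : k ∈ ((toep φ hφ).range)ᗮ) :
    ContinuousLinearMap.adjoint shift k ∈ ((toep φ hφ).range)ᗮ := by
  rw [Submodule.mem_orthogonal] at hk ⊢
  rintro _ ⟨f, rfl⟩
  rw [ContinuousLinearMap.adjoint_inner_right]
  refine hk _ ⟨shift f, Subtype.ext ?_⟩
  exact mulOp_comm hφ (isInner_mono zero_le_one) f

/-- An inner function `φ` for which `φ H²` is a proper subspace of finite codimension in `H²`
has a zero in the disk. -/
theorem exists_diskExt_eq_zero {φ : L2} (hφ : IsInner φ) (htop : (toep φ hφ).range ≠ ⊤)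
    [FiniteDimensional ℂ (H2 ⧸ (toep φ hφ).range)] :
    ∃ a : ℂ, ‖a‖ < 1 ∧ diskExt φ a = 0 := by
  have e := quotientEquivModel φ hφ
  have : FiniteDimensional ℂ ((toep φ hφ).range)ᗮ := e.finiteDimensional
  have : Nontrivial (H2 ⧸ (toep φ hφ).range) := Submodule.Quotient.nontrivial_iff.2 htop
  have : Nontrivial ((toep φ hφ).range)ᗮ := e.symm.toEquiv.nontrivial
  obtain ⟨l, hl⟩ := Module.End.exists_eigenvalue
    ((ContinuousLinearMap.adjoint shift : H2 →ₗ[ℂ] H2).restrict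
      fun _ hk => adjoint_shift_mem hφ hk)
  obtain ⟨k, hk⟩ := hl.exists_hasEigenvector
  have hSk : ContinuousLinearMap.adjoint shift (k : H2) = l • (k : H2) :=
    congrArg Subtype.val hk.apply_eq_smul
  -- The adjoint of the shift lowers indices by one, so an eigenvector has geometric coefficients `l
  -- ^ n` times its zeroth one, which is therefore nonzero.
  have hrec : ∀ n : ℕ, coeff ((k : H2) : L2) (n + 1) = l * coeff ((k : H2) : L2) n := fun n => by
    rw [← coeff_adjoint_shift, hSk, Submodule.coe_smul, coeff_eq_inner, inner_smul_right,
      ← coeff_eq_inner]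
  have hpow : ∀ n : ℕ, coeff ((k : H2) : L2) n = l ^ n * coeff ((k : H2) : L2) 0 := fun n => by
    induction n with
    | zero => simp
    | succ n ih => rw [Nat.cast_succ, hrec, ih, pow_succ']; ring
  have h0 : coeff ((k : H2) : L2) 0 ≠ 0 := fun h0 => by
    refine hk.2 (Subtype.ext (Subtype.ext (coeff_ext fun n => ?_)))
    have hz : coeff (0 : L2) n = 0 := by rw [coeff_eq_inner, inner_zero_right]
    refine Eq.trans ?_ hz.symm
    rcases lt_or_ge n 0 with hn | hn
    · exact mem_H2.1 (k : H2).2 n hn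
    · lift n to ℕ using hn
      rw [hpow, h0, mul_zero]
  -- The coefficients of an `L²` function tend to `0`, so the geometric ratio lies in the open disk.
  have hl1 : ‖l‖ < 1 := by
    have h1 := tendsto_coeff_atTop ((k : H2) : L2)
    simp only [hpow] at h1
    have h2 := h1.mul_const (coeff ((k : H2) : L2) 0)⁻¹
    simp only [mul_inv_cancel_right₀ h0, zero_mul] at h2
    exact tendsto_pow_atTop_nhds_zero_iff_norm_lt_one.1 h2
  refine ⟨conj l, by rwa [RCLike.norm_conj], ?_⟩
  have hφ1 : (toep φ hφ ⟨mono 0, mono_mem_H2 le_rfl⟩ : L2) = φ := by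
    refine Lp.ext ?_
    filter_upwards [coeFn_toep φ hφ ⟨mono 0, mono_mem_H2 le_rfl⟩, coeFn_mono 0] with t h1 h2
    rw [h1, h2, fourier_zero, mul_one]
  -- Here `φ = φ · 1 ∈ φ H²`. By Parseval the inner product is `conj (coeff k 0)` times the value of
  -- `φ` at `conj l`.
  have horth : inner ℂ ((k : H2) : L2) φ = 0 := by
    have h := (Submodule.mem_orthogonal' _ _).1 k.2
      (toep φ hφ ⟨mono 0, mono_mem_H2 le_rfl⟩) ⟨_, rfl⟩
    rwa [Submodule.coe_inner, hφ1] at h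
  have hs := hasSum_conj_coeff_mul_coeff ((k : H2) : L2) φ
  rw [horth, ← Nat.cast_injective (R := ℤ) |>.hasSum_iff] at hs
  · have hd := (hasSum_diskExt φ (z := conj l) (by rwa [RCLike.norm_conj])).mul_left
      (conj (coeff ((k : H2) : L2) 0))
    have h2 := hd.unique (hs.congr_fun fun n => by
      rw [Function.comp_apply, hpow, map_mul, map_pow]; ring)
    exact (mul_eq_zero.1 h2).resolve_left ((map_ne_zero _).2 h0)
  · intro n hn
    have hn0 : n < 0 := by
      by_contra h
      exact hn ⟨n.toNat, Int.toNat_of_nonneg (not_lt.1 h)⟩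
    rw [coeff, coeff, mem_H2.1 (k : H2).2 n hn0, map_zero, zero_mul]

/-! ### Degree equals codimension. -/

theorem isBlaschkeOfDegree_succ_iff {φ : L2} {n : ℕ} (hφ : IsInner φ) :
    IsBlaschkeOfDegree φ (n + 1) ↔ ∃ (a : ℂ) (_ : ‖a‖ < 1) (ψ : L2),
      IsInner ψ ∧ IsBlaschkeOfDegree ψ n ∧
        (φ : Circ → ℂ) =ᵐ[arc] fun t => blaschkeFactor a (fourier 1 t) * ψ t := by
  constructor
  · rintro ⟨c, a, hc, ha, h⟩
    have hz : diskExt φ (a 0) = 0 := by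
      rw [h _ (ha 0), Fin.prod_univ_succ, (blaschkeFactor_eq_zero_iff (ha 0) (ha 0)).2 rfl]
      ring
    obtain ⟨ψ, hψ, hφψ⟩ := exists_isInner_blaschke_mul (ha 0) hφ hz
    refine ⟨a 0, ha 0, ψ, hψ, ⟨c, fun j => a j.succ, hc, fun j => ha _, fun z hz => ?_⟩, hφψ⟩
    have hcont : ContinuousAt (fun z => c * ∏ j : Fin n, blaschkeFactor (a j.succ) z) (a 0) :=
      continuousAt_const.mul (Finset.analyticAt_fun_prod _ fun j _ =>
        analyticAt_blaschkeFactor (ha j.succ) (ha 0)).continuousAt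
    refine diskExt_eq_of_blaschkeFactor_mul_eq (ha 0) hcont (fun w hw => ?_) hz
    rw [← diskExt_blaschke_mul (ha 0) hφ.mem_H2 hψ.mem_H2 hφψ hw, h w hw, Fin.prod_univ_succ]
    ring
  · rintro ⟨a, ha, ψ, hψ, ⟨c, b, hc, hb, h⟩, hφψ⟩
    refine ⟨c, Fin.cons a b, hc, Fin.cases ha hb, fun z hz => ?_⟩
    rw [diskExt_blaschke_mul ha hφ.mem_H2 hψ.mem_H2 hφψ hz, h z hz, Fin.prod_univ_succ]
    simp only [Fin.cons_zero, Fin.cons_succ]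
    ring

/-- An inner function is a Blaschke product with `n` factors if and only if `φ H²` has
codimension `n` in `H²`. -/
theorem isBlaschkeOfDegree_iff_rank {n : ℕ} : ∀ {φ : L2} (hφ : IsInner φ),
    IsBlaschkeOfDegree φ n ↔ Module.rank ℂ (H2 ⧸ (toep φ hφ).range) = n := by
  induction n with
  | zero =>
    intro φ hφ
    rw [isBlaschkeOfDegree_zero_iff hφ, Nat.cast_zero, rank_zero_iff,
      Submodule.Quotient.subsingleton_iff]
  | succ n ih =>
    intro φ hφ
    rw [isBlaschkeOfDegree_succ_iff hφ]
    constructor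
    · rintro ⟨a, ha, ψ, hψ, hn, h⟩
      rw [rank_quotient_range_toep_mul ha hφ hψ h, (ih hψ).1 hn, Nat.cast_succ, add_comm]
    -- Codimension `n + 1` is finite and nonzero, so `φ` has a zero; dividing by its Blaschke factor
    -- lowers the codimension by exactly one.
    · intro hr
      have : FiniteDimensional ℂ (H2 ⧸ (toep φ hφ).range) :=
        Module.rank_lt_aleph0_iff.1 (hr ▸ Cardinal.natCast_lt_aleph0)
      have htop : (toep φ hφ).range ≠ ⊤ := fun h => by
        rw [rank_zero_iff.2 (Submodule.Quotient.subsingleton_iff.2 h)] at hr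
        exact Nat.succ_ne_zero n (by exact_mod_cast hr.symm)
      obtain ⟨a, ha, hz⟩ := exists_diskExt_eq_zero hφ htop
      obtain ⟨ψ, hψ, h⟩ := exists_isInner_blaschke_mul ha hφ hz
      refine ⟨a, ha, ψ, hψ, (ih hψ).2 ?_, h⟩
      rw [rank_quotient_range_toep_mul ha hφ hψ h, Nat.cast_succ, add_comm] at hr
      exact Cardinal.add_one_inj.1 hr

theorem isFiniteBlaschke_iff_finiteDimensional {φ : L2} (hφ : IsInner φ) :
    IsFiniteBlaschke φ ↔ FiniteDimensional ℂ (H2 ⧸ (toep φ hφ).range) := by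
  rw [isFiniteBlaschke_iff]
  constructor
  · rintro ⟨n, hn⟩
    exact Module.rank_lt_aleph0_iff.1
      ((isBlaschkeOfDegree_iff_rank hφ).1 hn ▸ Cardinal.natCast_lt_aleph0)
  · intro _
    exact ⟨_, (isBlaschkeOfDegree_iff_rank hφ).2 (Module.finrank_eq_rank _ _).symm⟩

/-! ### The restricted Grassmannian. -/

theorem coe_orthogonalProjectionOnto_subtype {W : Submodule ℂ L2} (hW : W ≤ H2) (w : W) :
    ((H2.orthogonalProjectionOnto ∘L W.subtypeL) w : L2) = w :=
  H2.starProjection_eq_self_iff.2 (hW w.2)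

theorem isometry_orthogonalProjectionOnto_subtype {W : Submodule ℂ L2} (hW : W ≤ H2) :
    Isometry (H2.orthogonalProjectionOnto ∘L W.subtypeL) :=
  AddMonoidHomClass.isometry_of_norm _ fun w => by
    change ‖((H2.orthogonalProjectionOnto ∘L W.subtypeL) w : L2)‖ = ‖(w : L2)‖
    rw [coe_orthogonalProjectionOnto_subtype hW]

theorem range_orthogonalProjectionOnto_mulH2 (φ : L2) (hφ : IsInner φ) :
    (H2.orthogonalProjectionOnto ∘L (mulH2 φ hφ).subtypeL).range = (toep φ hφ).range := by
  ext f
  rw [mem_range_toep]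
  constructor
  · rintro ⟨w, rfl⟩
    exact (coe_orthogonalProjectionOnto_subtype (mulH2_le φ hφ) w).symm ▸ w.2
  · intro hf
    exact ⟨⟨f, hf⟩, Subtype.ext (coe_orthogonalProjectionOnto_subtype (mulH2_le φ hφ) ⟨f, hf⟩)⟩

theorem orthogonalProjectionOnto_orthogonal_comp_subtypeL {W : Submodule ℂ L2} (hW : W ≤ H2) :
    H2ᗮ.orthogonalProjectionOnto ∘L W.subtypeL = 0 := by
  rw [Submodule.orthogonalProjectionOnto_comp_subtypeL_eq_zero_iff, Submodule.isOrtho_iff_le]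
  exact Submodule.orthogonal_le hW

theorem innerProj_mem_GrRes_iff (φ : L2) (hφ : IsInner φ) (k : ℤ) :
    innerProj φ hφ ∈ GrRes k ↔ FiniteDimensional ℂ (H2 ⧸ (toep φ hφ).range) ∧
      -(Module.finrank ℂ (H2 ⧸ (toep φ hφ).range) : ℤ) = k := by
  have hrange : (innerProj φ hφ).range = mulH2 φ hφ := Submodule.range_starProjection _
  have hiso := isometry_orthogonalProjectionOnto_subtype (mulH2_le φ hφ)
  -- `finrank` is `0` on an infinite-dimensional cokernel, so the index alone does not detect
  -- finiteness, which is a separate conjunct.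
  have hindex : (H2.orthogonalProjectionOnto ∘L (mulH2 φ hφ).subtypeL).toLinearMap.index
      = -(Module.finrank ℂ (H2 ⧸ (toep φ hφ).range) : ℤ) := by
    rw [LinearMap.index_of_injective hiso.injective, range_orthogonalProjectionOnto_mulH2]
  have hker : (H2.orthogonalProjectionOnto ∘L (mulH2 φ hφ).subtypeL).ker = ⊥ :=
    LinearMap.ker_eq_bot.2 hiso.injective
  simp only [GrRes, IsInGrRes, Set.mem_ofPred_eq]
  rw [hrange, hindex]
  constructor
  · rintro ⟨-, ⟨-, hF, -⟩, hk⟩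
    have := hF.finite_coker
    rw [range_orthogonalProjectionOnto_mulH2] at this
    exact ⟨this, hk⟩
  · rintro ⟨hfin, hk⟩
    refine ⟨isStarProjection_starProjection, ⟨?_, ⟨?_, ?_, ?_, ?_, ?_⟩, ?_⟩, hk⟩
    · exact isClosed_mulH2 φ hφ
    · exact hiso.isEmbedding.isStrictMap
    · rw [range_orthogonalProjectionOnto_mulH2]
      exact isClosed_range_toep φ hφ
    · rw [hker]
      infer_instance
    · rwa [range_orthogonalProjectionOnto_mulH2]
    · rw [hker]
      exact Submodule.closedComplemented_bot
    · rw [orthogonalProjectionOnto_orthogonal_comp_subtypeL (mulH2_le φ hφ)]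
      exact isCompactOperator_zero

/-! ### The Calkin algebra and the essential class. -/

theorem Pplus_apply_of_mem {f : L2} (hf : f ∈ H2) : Pplus f = f :=
  H2.starProjection_eq_self_iff.2 hf

theorem Pplus_mul_innerProj (φ : L2) (hφ : IsInner φ) :
    Pplus * innerProj φ hφ = innerProj φ hφ := by
  ext1 f
  exact Pplus_apply_of_mem (mulH2_le φ hφ (Submodule.starProjection_apply_mem _ f))

theorem innerProj_mul_Pplus (φ : L2) (hφ : IsInner φ) :
    innerProj φ hφ * Pplus = innerProj φ hφ := by
  have h := congrArg star (Pplus_mul_innerProj φ hφ)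
  have hP : star Pplus = Pplus := isStarProjection_starProjection.isSelfAdjoint.star_eq
  have hQ : star (innerProj φ hφ) = innerProj φ hφ :=
    isStarProjection_starProjection.isSelfAdjoint.star_eq
  rwa [star_mul, hP, hQ] at h

theorem Pminus_eq : Pminus = 1 - Pplus := Submodule.starProjection_orthogonal' H2

theorem Pminus_mul_innerProj (φ : L2) (hφ : IsInner φ) : Pminus * innerProj φ hφ = 0 := by
  rw [Pminus_eq, sub_mul, one_mul, Pplus_mul_innerProj, sub_self]

theorem innerProj_mul_Pminus (φ : L2) (hφ : IsInner φ) : innerProj φ hφ * Pminus = 0 := by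
  rw [Pminus_eq, mul_sub, mul_one, innerProj_mul_Pplus, sub_self]

theorem innerProj_apply_toep (φ : L2) (hφ : IsInner φ) (f : H2) :
    innerProj φ hφ (toep φ hφ f : L2) = toep φ hφ f :=
  (mulH2 φ hφ).starProjection_eq_self_iff.2 (mem_range_toep.1 ⟨f, rfl⟩)

theorem innerProj_apply_of_mem_orthogonal {φ : L2} {hφ : IsInner φ} {k : H2}
    (hk : k ∈ ((toep φ hφ).range)ᗮ) : innerProj φ hφ k = 0 := by
  refine (mulH2 φ hφ).starProjection_apply_eq_zero_iff.2 ?_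
  rw [Submodule.mem_orthogonal]
  intro w hw
  exact (Submodule.mem_orthogonal _ _).1 hk ⟨w, mulH2_le φ hφ hw⟩ (mem_range_toep.2 hw)

theorem not_finiteDimensional_H2 : ¬ FiniteDimensional ℂ H2 := fun _ => by
  have h : Orthonormal ℂ fun n : ℕ => (⟨mono n, mono_mem_H2 (Int.natCast_nonneg n)⟩ : H2) := by
    have h1 := (fourierBasis (T := 2 * Real.pi)).orthonormal.comp _ (Nat.cast_injective (R := ℤ))
    exact ⟨fun n => h1.1 n, fun m n hmn => h1.2 hmn⟩
  exact not_finite_iff_infinite.2 inferInstance h.linearIndependent.finite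

/-- `P_φ` fixes the range of the isometry `T_φ`, so compressing it by `T_φ` and its adjoint gives
the identity of the infinite-dimensional space `H²`. -/
theorem not_isCompactOperator_innerProj (φ : L2) (hφ : IsInner φ) :
    ¬ IsCompactOperator (innerProj φ hφ) := fun h => by
  have h1 := (h.comp_clm (H2.subtypeL ∘L toep φ hφ)).clm_comp
    (ContinuousLinearMap.adjoint (toep φ hφ) ∘L H2.orthogonalProjectionOnto)
  refine not_finiteDimensional_H2 (FiniteDimensional.of_isCompactOperator_id (𝕜 := ℂ)
    ((congrArg IsCompactOperator (funext fun f => ?_)).mpr h1))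
  have hP : H2.orthogonalProjectionOnto (toep φ hφ f : L2) = toep φ hφ f :=
    H2.orthogonalProjectionOnto_mem_subspace_eq_self _
  have hT : ContinuousLinearMap.adjoint (toep φ hφ) (toep φ hφ f) = f := by
    refine ext_inner_right ℂ fun g => ?_
    rw [ContinuousLinearMap.adjoint_inner_left]
    exact (mulOp φ hφ).inner_map_map f g
  change f = ContinuousLinearMap.adjoint (toep φ hφ)
    (H2.orthogonalProjectionOnto (innerProj φ hφ (toep φ hφ f : L2)))
  rw [innerProj_apply_toep, hP, hT]

/-- `P_+ - P_φ` is the projection onto the model space: the identity there is compact only in finite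
dimension, and conversely the projection factors through that space. -/
theorem isCompactOperator_Pplus_sub_innerProj_iff (φ : L2) (hφ : IsInner φ) :
    IsCompactOperator (Pplus - innerProj φ hφ) ↔
      FiniteDimensional ℂ (H2 ⧸ (toep φ hφ).range) := by
  set K := ((toep φ hφ).range)ᗮ
  have happ : ∀ k : K, (Pplus - innerProj φ hφ) ((k : H2) : L2) = (k : H2) := fun k => by
    rw [sub_apply, innerProj_apply_of_mem_orthogonal k.2, sub_zero,
      Pplus_apply_of_mem (k : H2).2]
  constructor
  · intro h
    have h1 := (h.comp_clm (H2.subtypeL ∘L K.subtypeL)).clm_comp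
      (K.orthogonalProjectionOnto ∘L H2.orthogonalProjectionOnto)
    have : FiniteDimensional ℂ K := by
      refine FiniteDimensional.of_isCompactOperator_id (𝕜 := ℂ)
        ((congrArg IsCompactOperator (funext fun k => ?_)).mpr h1)
      change k = K.orthogonalProjectionOnto
        (H2.orthogonalProjectionOnto ((Pplus - innerProj φ hφ) ((k : H2) : L2)))
      rw [happ, H2.orthogonalProjectionOnto_mem_subspace_eq_self,
        K.orthogonalProjectionOnto_mem_subspace_eq_self]
    exact (quotientEquivModel φ hφ).symm.finiteDimensional
  · intro _
    have : FiniteDimensional ℂ K := (quotientEquivModel φ hφ).finiteDimensional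
    have : ProperSpace K := FiniteDimensional.proper ℂ K
    have h1 : IsCompactOperator (K.orthogonalProjectionOnto ∘L H2.orthogonalProjectionOnto) :=
      (isCompactOperator_id (E := K)).comp_clm
        (K.orthogonalProjectionOnto ∘L H2.orthogonalProjectionOnto)
    have h2 := h1.clm_comp (H2.subtypeL ∘L K.subtypeL)
    refine (congrArg IsCompactOperator (funext fun f => ?_)).mpr h2
    set g := H2.orthogonalProjectionOnto f
    have hPf : innerProj φ hφ f = innerProj φ hφ (g : L2) :=
      (DFunLike.congr_fun (innerProj_mul_Pplus φ hφ) f).symm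
    -- The range of `T_φ` is closed, hence equal to its double orthogonal complement.
    obtain ⟨r, hr⟩ : g - K.orthogonalProjectionOnto g ∈ (toep φ hφ).range :=
      (Submodule.orthogonal_orthogonal _).le (K.sub_starProjection_mem_orthogonal g)
    have hsplit : (g : L2) = toep φ hφ r + (K.orthogonalProjectionOnto g : H2) := by
      have h4 : toep φ hφ r = g - K.orthogonalProjectionOnto g := hr
      rw [h4, Submodule.coe_sub, sub_add_cancel]
    change (g : L2) - innerProj φ hφ f = (K.orthogonalProjectionOnto g : H2)
    rw [hPf, hsplit, map_add, innerProj_apply_toep,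
      innerProj_apply_of_mem_orthogonal (K.orthogonalProjectionOnto g).2, add_zero,
      add_sub_cancel_left]

/-- The only possible corner entry is `p = π(P_φ)`, and every condition except `p ≠ π(P_+)` holds
for all inner `φ`. -/
theorem innerProj_mem_EssE1_iff (φ : L2) (hφ : IsInner φ) :
    innerProj φ hφ ∈ EssE1 ↔ ¬ FiniteDimensional ℂ (H2 ⧸ (toep φ hφ).range) := by
  have hcorner : Pplus * innerProj φ hφ * Pplus = innerProj φ hφ := by
    rw [Pplus_mul_innerProj, innerProj_mul_Pplus]
  have hiff : calkinMap L2 (innerProj φ hφ) = calkinMap L2 Pplus ↔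
      FiniteDimensional ℂ (H2 ⧸ (toep φ hφ).range) := by
    rw [eq_comm, ← sub_eq_zero, ← map_sub, calkinMap_eq_zero,
      isCompactOperator_Pplus_sub_innerProj_iff]
  have hP : IsStarProjection (innerProj φ hφ) := isStarProjection_starProjection
  rw [← hiff]
  constructor
  · rintro ⟨-, -, p, -, -, -, hp, hpp, -⟩
    rwa [← hpp, hcorner] at hp
  · intro h
    refine ⟨hP, ?_, calkinMap L2 (innerProj φ hφ), ⟨?_, ?_⟩, ?_, ?_, h, ?_, ?_, ?_, ?_⟩
    · change IsCompactOperator (innerProj φ hφ * Pplus - Pplus * innerProj φ hφ)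
      rw [innerProj_mul_Pplus, Pplus_mul_innerProj, sub_self]
      exact isCompactOperator_zero
    · rw [IsIdempotentElem, ← map_mul, hP.isIdempotentElem]
    · rw [isSelfAdjoint_iff, star_calkinMap, hP.isSelfAdjoint.star_eq]
    · rw [← map_mul, ← map_mul, hcorner]
    · rw [Ne, calkinMap_eq_zero]
      exact not_isCompactOperator_innerProj φ hφ
    · rw [hcorner]
    · rw [Pplus_mul_innerProj, innerProj_mul_Pminus, map_zero]
    · rw [Pminus_mul_innerProj, zero_mul, map_zero]
    · rw [Pminus_mul_innerProj, zero_mul, map_zero]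

end HardySpace

end

theorem mainTheorem3 (φ : HardySpace.L2) (hφ : HardySpace.IsInner φ) :
    (HardySpace.IsFiniteBlaschke φ ↔
      ∃ k : ℕ, HardySpace.numZeros φ = (k : ℕ∞) ∧
        HardySpace.innerProj φ hφ ∈ HardySpace.GrRes (-(k : ℤ))) ∧
    (¬ HardySpace.IsFiniteBlaschke φ ↔ HardySpace.innerProj φ hφ ∈ HardySpace.EssE1) := by
  refine ⟨⟨fun h => ?_, ?_⟩, ?_⟩
  · have hfin := (HardySpace.isFiniteBlaschke_iff_finiteDimensional hφ).1 h
    obtain ⟨n, hn⟩ := HardySpace.isFiniteBlaschke_iff.1 h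
    refine ⟨n, hn.numZeros_eq, (HardySpace.innerProj_mem_GrRes_iff φ hφ _).2 ⟨hfin, ?_⟩⟩
    rw [Module.finrank_eq_of_rank_eq ((HardySpace.isBlaschkeOfDegree_iff_rank hφ).1 hn)]
  · rintro ⟨k, -, hk⟩
    exact (HardySpace.isFiniteBlaschke_iff_finiteDimensional hφ).2
      ((HardySpace.innerProj_mem_GrRes_iff φ hφ _).1 hk).1
  · rw [HardySpace.isFiniteBlaschke_iff_finiteDimensional hφ,
      HardySpace.innerProj_mem_EssE1_iff]
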